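/- Let $X,Y,Z$ be real locally convex Hausdorff topological vector spaces with topological duals $X^*,Y^*,Z^*$, let $K\subsetneq Y$ be a closed convex cone with $\operatorname{int}K\neq\emptyset$, and let $S\subset Z$ be a nonempty closed convex cone with dual cone $S^+=\{z^*\in Z^*:\langle z^*,s\rangle\ge 0\ \forall s\in S\}$ (and $K^+\subset Y^*$ likewise). Put $Y^\bullet=Y\cup\{-\infty_Y,+\infty_Y\}$ and $Z^\bullet=Z\cup\{-\infty_Z,+\infty_Z\}$, where $(\pm\infty)+y=y+(\pm\infty)=\pm\infty$, and write $y_1<_Ky_2$ for $y_1-y_2\in-\operatorname{int}K$, with $-\infty_Y<_Ky<_K+\infty_Y$ for $y\in Y$ and $-\infty_Y<_K+\infty_Y$. Let $\mathcal U\ne\emptyset$ be a set, let $F:X\to Y^\bullet$ and $G_u:X\to Z^\bullet$ ($u\in\mathcal U$) be proper mappings (never equal to $-\infty$, not identically $+\infty$), let $C\subset X$, and put $$A=C\cap\bigcap_{u\in\mathcal U}G_u^{-1}(-S),\qquad \operatorname{dom}F=\{x\in X: F(x)\neq+\infty_Y\},\qquad A\cap\operatorname{dom}F\ne\emptyset .$$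 Let $\mathcal L(X,Y)$ be the space of continuous linear mappings $X\to Y$ with the topology of pointwise convergence. For $M\subset Y^\bullet$ let $\operatorname{WSup}M$ be the set of all $\bar v\in Y^\bullet$ such that $\bar v\not<_Kv$ for all $v\in M$, and for every $\tilde v\in Y^\bullet$ with $\tilde v<_K\bar v$ there is $v\in M$ with $\tilde v<_Kv$. For $H:X\to Y^\bullet$ let $H^*(L)=\operatorname{WSup}\{L(x)-H(x):x\in X\}$ and $\operatorname{epi}H^*=\{(L,y)\in\mathcal L(X,Y)\times Y:y\in H^*(L)+K\}$. Let $I_C$ be the indicator mapping ($I_C(x)=0_Y$ if $x\in C$ and $+\infty_Y$ otherwise), and for a continuous linear $T:Z\to Y$ let $(T\circ G_u)(x)=T(G_u(x))$ if $G_u(x)\in Z$ and $+\infty_Y$ if $G_u(x)=+\infty_Z$. For $k\in\operatorname{int}K$ and a continuous linear functional $\xi$ on $X$ or $Z$, let $(k\cdot \xi)(v)=\langle \xi,v\rangle k$, and put $$\mathcal A_k=\bigcup_{(z^*,u)\in S^+\times\mathcal U}\operatorname{epi}\bigl(F+I_C+(k\cdot z^*)\circ G_u\bigr)^*,\qquad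 E_k=\{(k\cdot x^*,rk):x^*\in X^*,\ r\in\mathbb R\}.$$ A set $N\subset\mathcal L(X,Y)\times Y$ is $k$-sectionally convex if $N\cap(E_k+e)$ is convex for every $e\in\mathcal L(X,Y)\times Y$; $\operatorname{sco}_kN$ is the intersection of all $k$-sectionally convex sets containing $N$. Assume $(\mathcal H_0)$: $F$ is $K$-convex (the set $\{(x,y)\in X\times Y: y\in F(x)+K\}$ is convex) and positively $K$-lsc ($y^*\circ F$ is lower semicontinuous for every $y^*\in K^+\setminus\{0\}$, with $(y^*\circ F)(x)=+\infty$ where $F(x)=+\infty_Y$); for every $u\in\mathcal U$ the set $\{(x,z)\in X\times Z: z\in G_u(x)+S\}$ is convex and closed; and $C$ is nonempty, closed and convex. Let $\emptyset\neq\mathcal V\subset\mathcal L(X,Y)$ and $\emptyset\ne\mathcal W\subset Y$, and suppose there is $k\in\operatorname{int}K$ such that $\mathcal A_k$ is $k$-sectionally convex and closed regarding $\mathcal V\times\mathcal W$, i.e. $$\operatorname{cl}(\operatorname{sco}_k\mathcal A_k)\cap(\mathcal V\times\mathcal W)=\mathcal A_k\cap(\mathcal V\times\mathcal W).$$ Then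 both of the following hold. (c) For every $(L,y)\in\mathcal V\times\mathcal W$, the following two assertions are equivalent: - $(\alpha)$ for every $x\in C$ with $G_u(x)\in-S$ for all $u\in\mathcal U$, one has $y-L(x)+F(x)\notin-\operatorname{int}K$; - $(\beta)$ there are $u\in\mathcal U$ and a continuous linear $T:Z\to Y$ with $T(S)\subset K$ such that $F(x)+(T\circ G_u)(x)-L(x)+y\notin-\operatorname{int}K$ for all $x\in C$. (d) For every $(L,y)\in\mathcal V\times\mathcal W$, assertion $(\alpha)$ is equivalent to - $(\gamma)$ there are $u\in\mathcal U$ and a continuous linear $T:Z\to Y$ with $T(S)\cap(-\operatorname{int}K)=\emptyset$ such that $F(x)+(T\circ G_u)(x)-L(x)+y\notin-T(S)-\operatorname{int}K$ for all $x\in C$. -/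

import Mathlib

open Set Topology
open scoped Pointwise

namespace RobustFarkas

/-! ### The extended space and its weak order -/

/-- The set `Y ∪ {-∞_Y, +∞_Y}`. -/
inductive Bullet (Y : Type*) where
  | negInf : Bullet Y
  | fin : Y → Bullet Y
  | posInf : Bullet Y

namespace Bullet

variable {Y : Type*}

/-- Addition extends that of `Y`, with `(±∞) + y = y + (±∞) = ±∞` and `(±∞) + (±∞) = ±∞`.
The sums of infinities of opposite signs are undefined in the theory; the value chosen here is
irrelevant, as such sums do not occur for proper mappings. -/
instance [Add Y] : Add (Bullet Y) where
  add
    | negInf, _ => negInf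
    | _, negInf => negInf
    | posInf, _ => posInf
    | _, posInf => posInf
    | fin a, fin b => fin (a + b)

instance [Neg Y] : Neg (Bullet Y) where
  neg
    | negInf => posInf
    | fin a => fin (-a)
    | posInf => negInf

/-- The weak order `a <_K b`: for points of `Y` it means `a - b ∈ -int K`, and
`-∞ <_K y <_K +∞` for every `y ∈ Y`, `-∞ <_K +∞`. -/
def WeakLT [AddGroup Y] [TopologicalSpace Y] (K : Set Y) : Bullet Y → Bullet Y → Prop
  | negInf, negInf => False
  | negInf, fin _ => True
  | negInf, posInf => True
  | fin _, negInf => False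
  | fin a, fin b => a - b ∈ -interior K
  | fin _, posInf => True
  | posInf, _ => False

/-- The weak supremum of `M`: the set of all weakly supremal elements of `M`.
For `M = ∅` this is `{-∞}`. -/
def wsup [AddGroup Y] [TopologicalSpace Y] (K : Set Y) (M : Set (Bullet Y)) :
    Set (Bullet Y) :=
  {v | (∀ w ∈ M, ¬ WeakLT K v w) ∧ ∀ t, WeakLT K t v → ∃ w ∈ M, WeakLT K t w}

/-- The composition of a real linear functional with the natural extension to infinite values. -/
noncomputable def toEReal (f : Y → ℝ) : Bullet Y → EReal
  | negInf => ⊥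
  | fin y => ((f y : ℝ) : EReal)
  | posInf => ⊤

/-- The extension of `T : Z → Y` to `T : Z ∪ {±∞_Z} → Y ∪ {±∞_Y}` that keeps infinite values
(the value at `-∞_Z` is never used for proper mappings). -/
def map {Z : Type*} (T : Z → Y) : Bullet Z → Bullet Y
  | negInf => negInf
  | fin z => fin (T z)
  | posInf => posInf

end Bullet

open Bullet

/-! ### Mappings into the extended space -/

section Mappings

variable {X Y : Type*}

/-- The effective domain. -/
def dom (F : X → Bullet Y) : Set X := {x | F x ≠ posInf}

/-- `F` is proper: its domain is nonempty and it never takes the value `-∞`. -/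
def IsProper (F : X → Bullet Y) : Prop := (dom F).Nonempty ∧ ∀ x, F x ≠ negInf

/-- The `K`-epigraph of `F : X → Y ∪ {±∞}`: the pairs `(x, y)` with `y ∈ F x + K`. -/
def epi [Add Y] (K : Set Y) (F : X → Bullet Y) : Set (X × Y) :=
  {p | ∃ κ ∈ K, fin p.2 = F p.1 + fin κ}

/-- `F` is `K`-convex: its `K`-epigraph is convex. -/
def IsKConvex [AddCommGroup X] [Module ℝ X] [AddCommGroup Y] [Module ℝ Y]
    (K : Set Y) (F : X → Bullet Y) : Prop := Convex ℝ (epi K F)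

/-- `F` is `K`-epi closed: its `K`-epigraph is closed. -/
def IsKEpiClosed [TopologicalSpace X] [Add Y] [TopologicalSpace Y]
    (K : Set Y) (F : X → Bullet Y) : Prop := IsClosed (epi K F)

/-- The (positive) dual cone `S⁺` in the topological dual. -/
def dualCone {Z : Type*} [AddCommGroup Z] [Module ℝ Z] [TopologicalSpace Z] (S : Set Z) :
    Set (Z →L[ℝ] ℝ) := {z' | ∀ s ∈ S, 0 ≤ z' s}

/-- `F` is positively `K`-lsc: `y' ∘ F` is lsc for every `y' ∈ K⁺ \ {0}`. -/
def IsPosKLsc [TopologicalSpace X] [AddCommGroup Y] [Module ℝ Y] [TopologicalSpace Y]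
    (K : Set Y) (F : X → Bullet Y) : Prop :=
  ∀ y' ∈ dualCone K, y' ≠ 0 → LowerSemicontinuous fun x => (F x).toEReal y'

open Classical in
/-- The indicator mapping of a set. -/
noncomputable def indic [Zero Y] (D : Set X) : X → Bullet Y :=
  fun x => if x ∈ D then fin 0 else posInf

end Mappings

/-! ### Conjugates; `X →Lₚₜ[ℝ] Y` is the space of continuous linear mappings with the topology
of pointwise convergence -/

section Conjugate

variable {X Y : Type*} [AddCommGroup X] [Module ℝ X] [TopologicalSpace X]
  [AddCommGroup Y] [Module ℝ Y] [TopologicalSpace Y]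

/-- The conjugate mapping `F^*(L) = wsup {L x - F x : x ∈ X}`. -/
def conj (K : Set Y) (F : X → Bullet Y) (L : X →Lₚₜ[ℝ] Y) : Set (Bullet Y) :=
  wsup K (range fun x => fin (L x) + -F x)

/-- The `K`-epigraph of `F^*`: the pairs `(L, y)` with `y ∈ F^*(L) + K`. -/
def epiConj (K : Set Y) (F : X → Bullet Y) : Set ((X →Lₚₜ[ℝ] Y) × Y) :=
  {p | ∃ v ∈ conj K F p.1, ∃ κ ∈ K, fin p.2 = v + fin κ}

end Conjugate

/-! ### Sectional convexity -/

section Sectional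

/-- `N` is `E₀`-sectionally convex: `N ∩ (E₀ + v)` is convex for all `v`. -/
def IsSecConvex {E : Type*} [AddCommGroup E] [Module ℝ E] (E₀ : Submodule ℝ E) (N : Set E) :
    Prop :=
  ∀ v : E, Convex ℝ (N ∩ ((E₀ : Set E) + {v}))

/-- The `E₀`-sectionally convex hull: the intersection of all `E₀`-sectionally convex sets
that contain `N`. -/
def secHull {E : Type*} [AddCommGroup E] [Module ℝ E] (E₀ : Submodule ℝ E) (N : Set E) :
    Set E :=
  ⋂₀ {M | N ⊆ M ∧ IsSecConvex E₀ M}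

variable {X Y : Type*} [AddCommGroup X] [Module ℝ X] [TopologicalSpace X]
  [AddCommGroup Y] [Module ℝ Y] [TopologicalSpace Y] [IsTopologicalAddGroup Y]
  [ContinuousSMul ℝ Y]

/-- The mapping `k · x'`, sending `x` to `⟨x', x⟩ k`. -/
def kdot (k : Y) (x' : X →L[ℝ] ℝ) : X →L[ℝ] Y := x'.smulRight k

/-- The subspace `E_k = {(k · x', r k) : x' ∈ X^*, r ∈ ℝ}` of `L(X, Y) × Y`. -/
def Ek (k : Y) : Submodule ℝ ((X →Lₚₜ[ℝ] Y) × Y) where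
  carrier := {p | ∃ (x' : X →L[ℝ] ℝ) (r : ℝ), (∀ x, p.1 x = kdot k x' x) ∧ p.2 = r • k}
  zero_mem' := ⟨0, 0, by simp [kdot], by simp⟩
  add_mem' := by
    rintro p q ⟨x₁, r₁, h₁, h₁'⟩ ⟨x₂, r₂, h₂, h₂'⟩
    refine ⟨x₁ + x₂, r₁ + r₂, fun x => ?_, ?_⟩
    · have : (p + q).1 x = p.1 x + q.1 x := rfl
      rw [this, h₁, h₂]; simp [kdot, add_smul]
    · simp [h₁', h₂', add_smul]
  smul_mem' := by
    rintro c p ⟨x₁, r₁, h₁, h₁'⟩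
    refine ⟨c • x₁, c * r₁, fun x => ?_, ?_⟩
    · have : (c • p).1 x = c • p.1 x := rfl
      rw [this, h₁]; simp [kdot, mul_smul]
    · simp [h₁', mul_smul]

/-- `N` is `k`-sectionally convex and closed regarding `V × W`. -/
def IsSecConvexClosedRegarding (k : Y) (N : Set ((X →Lₚₜ[ℝ] Y) × Y))
    (V : Set (X →Lₚₜ[ℝ] Y)) (W : Set Y) : Prop :=
  closure (secHull (Ek k) N) ∩ (V ×ˢ W) = N ∩ (V ×ˢ W)

end Sectional

/-! ### Data of the robust problem -/

section Problem

variable {X Y Z U : Type*}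

/-- The feasible set `A = C ∩ ⋂ u, G_u⁻¹(-S)`. -/
def feasible [Neg Z] (C : Set X) (G : U → X → Bullet Z) (S : Set Z) : Set X :=
  C ∩ ⋂ u, (G u) ⁻¹' (fin '' (-S))

variable [AddCommGroup X] [Module ℝ X] [TopologicalSpace X]
  [AddCommGroup Y] [Module ℝ Y] [TopologicalSpace Y]
  [AddCommGroup Z] [Module ℝ Z] [TopologicalSpace Z]

/-- The cone of positive operators `L₊(S, K)`. -/
def posOp (S : Set Z) (K : Set Y) : Set (Z →L[ℝ] Y) := {T | T '' S ⊆ K}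

/-- The cone of weakly positive operators `L₊ʷ(S, K)`. -/
def weakPosOp (S : Set Z) (K : Set Y) : Set (Z →L[ℝ] Y) := {T | T '' S ∩ (-interior K) = ∅}

/-- The qualifying set `A_k`: the union over `(z', u) ∈ S⁺ × U` of the epigraphs of
`(F + I_C + (k · z') ∘ G_u)^*`. -/
def qualSet [IsTopologicalAddGroup Y] [ContinuousSMul ℝ Y]
    (K : Set Y) (S : Set Z) (F : X → Bullet Y) (G : U → X → Bullet Z) (C : Set X) (k : Y) :
    Set ((X →Lₚₜ[ℝ] Y) × Y) :=
  ⋃ z' ∈ dualCone S, ⋃ u : U,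
    epiConj K fun x => F x + indic C x + (G u x).map (kdot k z')

end Problem

end RobustFarkas

/-! Only (α) ⇒ multiplier is deep. Convexity and `exists_scalarization` give `f ∈ K⁺` with `f k = 1`
and `0 ≤ f (y - L x + F x)` for feasible `x`, so `x ↦ f (L x) - f y` is an affine minorant of `f ∘
F` on the feasible set.

For each `u` the scalarized epigraph perturbed in `Z` is closed and convex, so Hahn–Banach makes its
section at `z = 0` the epigraph of a supremum of affine minorants of Lagrangians
(`exists_lagrangian_minorant`). Let `Q` collect these minorants over all `u` and all multipliers.
Bipolar reasoning (`mem_closure_convexHull_of_minorant`) puts `(f ∘ L, f y)` in the weak-* closed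
convex hull of `Q`.

The affine continuous `sectionMap` carries this point to `(L, y)` and, since `f k = 1`, carries `Q`
into the qualifying set. Hence `(L, y)` is in the closed sectional hull; the qualification condition
puts it in the qualifying set itself, and the multiplier is `T = k · z'`. The remaining implications
are cone arithmetic. -/

namespace RobustFarkas

open Bullet

/-! ### Separation and affine minorants of scalar Lagrangians. -/

section Scalar

variable {X Z : Type*} [AddCommGroup X] [Module ℝ X] [TopologicalSpace X]
  [IsTopologicalAddGroup X] [ContinuousSMul ℝ X] [LocallyConvexSpace ℝ X]
  [AddCommGroup Z] [Module ℝ Z] [TopologicalSpace Z]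
  [IsTopologicalAddGroup Z] [ContinuousSMul ℝ Z] [LocallyConvexSpace ℝ Z]

/-- A functional that is bounded below on an upward ray has a nonnegative slope. -/
theorem nonneg_of_forall_lt_add_mul {a b c : ℝ} (h : ∀ n : ℝ, 0 ≤ n → c < a + n * b) :
    0 ≤ b := by
  by_contra! hb
  have h0 := h 0 le_rfl
  have h1 := h ((a - c) / (-b)) (div_nonneg (by linarith) (by linarith))
  have : (a - c) / (-b) * b = c - a := by
    rw [div_neg, neg_mul, div_mul_cancel₀ _ hb.ne, neg_sub]
  linarith

theorem dual_prod_apply {E : Type*} [AddCommGroup E] [Module ℝ E] [TopologicalSpace E]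
    (f : E × ℝ →L[ℝ] ℝ) (x : E) (t : ℝ) :
    f (x, t) = f (x, 0) + t * f (0, 1) := by
  have : ((x, t) : E × ℝ) = (x, 0) + t • ((0, 1) : E × ℝ) := by ext <;> simp
  rw [this, map_add, map_smul, smul_eq_mul]

/-- A point outside a closed convex set `D` of triples is separated from `D` by
continuous functionals. -/
theorem exists_separating_triple {D : Set (X × Z × ℝ)} (hDc : IsClosed D) (hDv : Convex ℝ D)
    {x₀ : X} {M : ℝ} (h₀ : (x₀, (0 : Z), M) ∉ D) :
    ∃ (p : X →L[ℝ] ℝ) (q : Z →L[ℝ] ℝ) (l c : ℝ), p x₀ + l * M < c ∧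
      ∀ x z t, (x, z, t) ∈ D → c < p x + q z + l * t := by
  obtain ⟨f, c, hc, hD⟩ := geometric_hahn_banach_point_closed hDv hDc h₀
  have key : ∀ x z t, f (x, z, t) = f (x, 0, 0) + f (0, z, 0) + f (0, 0, 1) * t := by
    intro x z t
    have : ((x, z, t) : X × Z × ℝ) = (x, 0, 0) + (0, z, 0) + t • (0, 0, 1) := by
      simp
    rw [this, map_add, map_add, map_smul, smul_eq_mul, mul_comm]
  refine ⟨f.comp (ContinuousLinearMap.inl ℝ X (Z × ℝ)),
    f.comp ((ContinuousLinearMap.inr ℝ X (Z × ℝ)).comp (ContinuousLinearMap.inl ℝ Z ℝ)),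
    f (0, 0, 1), c, ?_, fun x z t h => ?_⟩
  · rw [key] at hc
    have h0 : f (0, (0 : Z), (0 : ℝ)) = 0 := map_zero f
    change f (x₀, 0, 0) + _ < c
    linarith
  · have := hD _ h
    rw [key] at this
    exact this

/-- A closed convex perturbation set, monotone in the directions of `S` and of the nonnegative
reals, is cut off from any point outside its section at `0` by an affine minorant
of a Lagrangian. -/
theorem exists_lagrangian_minorant {S : ProperCone ℝ Z} {D : Set (X × Z × ℝ)}
    (hDc : IsClosed D) (hDv : Convex ℝ D)
    (hS : ∀ x z t, (x, z, t) ∈ D → ∀ s ∈ S, (x, z + s, t) ∈ D)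
    (ht : ∀ x z t, (x, z, t) ∈ D → ∀ t', t ≤ t' → (x, z, t') ∈ D)
    {x₁ : X} {t₁ t₂ : ℝ} (h₁ : (x₁, (0 : Z), t₁) ∈ D) (h₂ : (x₁, (0 : Z), t₂) ∉ D)
    {x₀ : X} {M : ℝ} (h₀ : (x₀, (0 : Z), M) ∉ D) :
    ∃ z' ∈ dualCone (S : Set Z), ∃ (p : X →L[ℝ] ℝ) (r : ℝ), M < p x₀ - r ∧
      ∀ x z t, (x, z, t) ∈ D → p x - r ≤ t + z' z := by
  -- `D` contains rays from `(x₁, 0, t₁)` upwards in `t` and along `S`; boundedness below on them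
  -- fixes the signs.
  have main : ∀ (p : X →L[ℝ] ℝ) (q : Z →L[ℝ] ℝ) (l c : ℝ),
      (∀ x z t, (x, z, t) ∈ D → c < p x + q z + l * t) →
      0 ≤ l ∧ q ∈ dualCone (S : Set Z) := by
    intro p q l c h
    constructor
    · apply nonneg_of_forall_lt_add_mul (a := p x₁ + l * t₁) (c := c)
      intro n hn
      have := h _ _ _ (ht _ _ _ h₁ (t₁ + n) (by linarith))
      rw [map_zero] at this
      linarith
    · intro s hs
      apply nonneg_of_forall_lt_add_mul (a := p x₁ + l * t₁) (c := c)
      intro n hn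
      have := h _ _ _ (hS _ _ _ h₁ (n • s) (S.smul_mem hs hn))
      rw [zero_add, map_smul, smul_eq_mul] at this
      linarith
  have normal : ∀ (x : X) (N : ℝ) (p : X →L[ℝ] ℝ) (q : Z →L[ℝ] ℝ) (l c : ℝ),
      p x + l * N < c → (∀ x z t, (x, z, t) ∈ D → c < p x + q z + l * t) → 0 < l →
      ∃ z' ∈ dualCone (S : Set Z), ∃ (p : X →L[ℝ] ℝ) (r : ℝ), N < p x - r ∧
      ∀ x z t, (x, z, t) ∈ D → p x - r ≤ t + z' z := by
    intro x N p q l c hc h hl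
    have hq := (main p q l c h).2
    refine ⟨l⁻¹ • q, fun s hs => mul_nonneg (inv_nonneg.2 hl.le) (hq s hs), -(l⁻¹ • p),
      -(l⁻¹ * c), ?_, fun x z t hx => ?_⟩
    · have : l⁻¹ * (p x + l * N) < l⁻¹ * c := mul_lt_mul_of_pos_left hc (inv_pos.2 hl)
      rw [mul_add, inv_mul_cancel_left₀ hl.ne'] at this
      simp only [neg_apply, smul_apply, smul_eq_mul]
      linarith
    · have : l⁻¹ * c < l⁻¹ * (p x + q z + l * t) :=
        mul_lt_mul_of_pos_left (h x z t hx) (inv_pos.2 hl)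
      rw [mul_add, mul_add, inv_mul_cancel_left₀ hl.ne'] at this
      simp only [neg_apply, smul_apply, smul_eq_mul]
      linarith
  obtain ⟨p, q, l, c, hc, h⟩ := exists_separating_triple hDc hDv h₀
  obtain ⟨hl, hq⟩ := main p q l c h
  rcases hl.lt_or_eq with hl | rfl
  · exact normal x₀ M p q l c hc h hl
  -- The separating functional is vertical (`l = 0`). Separating a point lying over `x₁` instead
  -- forces `l₁ ≠ 0`, which supplies one genuine affine minorant.
  obtain ⟨p₁, q₁, l₁, c₁, hc₁, hD₁⟩ := exists_separating_triple hDc hDv h₂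
  have hl₁ : 0 < l₁ := by
    have := hD₁ _ _ _ h₁
    rcases (main p₁ q₁ l₁ c₁ hD₁).1.lt_or_eq with h | rfl
    · exact h
    · rw [map_zero] at this; linarith
  obtain ⟨z₁, hz₁, p', r', -, hm⟩ := normal x₁ t₂ p₁ q₁ l₁ c₁ hc₁ hD₁ hl₁
  have hc' : 0 < c - p x₀ := by linarith
  -- Adding `n` times the vertical inequality `c < p x + q z` keeps a minorant and raises its value
  -- at `x₀` by `n * (c - p x₀)`, past `M` for large `n`.
  obtain ⟨n, hn⟩ := exists_nat_gt ((M - (p' x₀ - r')) / (c - p x₀))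
  rw [div_lt_iff₀ hc'] at hn
  refine ⟨z₁ + (n : ℝ) • q, fun s hs => ?_, p' - (n : ℝ) • p, r' - n * c, ?_,
    fun x z t hx => ?_⟩
  · exact add_nonneg (hz₁ s hs) (mul_nonneg n.cast_nonneg (hq s hs))
  · simp only [sub_apply, smul_apply, smul_eq_mul]
    linarith
  · have h1 := hm x z t hx
    have h2 := mul_le_mul_of_nonneg_left (h x z t hx).le (Nat.cast_nonneg (α := ℝ) n)
    simp only [sub_apply, add_apply,
      smul_apply, smul_eq_mul]
    linarith

end Scalar

/-! ### Affine minorants and weak-* closed convex hulls. -/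

section WeakStar

variable {X : Type*} [AddCommGroup X] [Module ℝ X] [TopologicalSpace X]

/-- If `P` is the epigraph of the supremum of the affine functions in `Q`, then every affine
minorant of `P` lies in the weak-* closed convex hull of `Q`. -/
theorem mem_closure_convexHull_of_minorant {Q : Set (WeakDual ℝ X × ℝ)} {P : Set (X × ℝ)}
    (hQ : ∀ p r, (p, r) ∈ Q → ∀ r', r ≤ r' → (p, r') ∈ Q)
    (hle : ∀ p r, (p, r) ∈ Q → ∀ x t, (x, t) ∈ P → p x - r ≤ t)
    (hsup : ∀ x M, (x, M) ∉ P → ∃ p r, (p, r) ∈ Q ∧ M < p x - r)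
    {x₁ : X} {t₁ : ℝ} (h₁ : (x₁, t₁) ∈ P) {p₀ : WeakDual ℝ X} {r₀ : ℝ}
    (h₀ : ∀ x t, (x, t) ∈ P → p₀ x - r₀ ≤ t) :
    (p₀, r₀) ∈ closure (convexHull ℝ Q) := by
  by_contra hn
  have : LocallyConvexSpace ℝ (WeakDual ℝ X) :=
    inferInstanceAs (LocallyConvexSpace ℝ (WeakBilin (topDualPairing ℝ X)))
  obtain ⟨f, c, hc, hf⟩ := geometric_hahn_banach_point_closed
    (convex_convexHull ℝ Q).closure isClosed_closure hn
  -- Weak-* continuous functionals are evaluations at points of `X`, so the separation takes place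
  -- in `X × ℝ`.
  obtain ⟨x, hx⟩ := LinearMap.dualEmbedding_surjective (topDualPairing ℝ X)
    (f.comp (ContinuousLinearMap.inl ℝ (WeakDual ℝ X) ℝ))
  set l := f (0, 1) with hl
  have hfx : ∀ p r, f (p, r) = p x + r * l := by
    intro p r
    rw [dual_prod_apply]
    congr 1
    exact (DFunLike.congr_fun hx p).symm
  have hfQ : ∀ p r, (p, r) ∈ Q → c < p x + r * l := fun p r h =>
    hfx p r ▸ hf _ (subset_closure (subset_convexHull ℝ Q h))
  rw [hfx] at hc
  have hl0 : 0 ≤ l := by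
    obtain ⟨p, r, hq, -⟩ := hsup x₁ (p₀ x₁ - r₀ - 1) fun h => by
      have := h₀ _ _ h; linarith
    apply nonneg_of_forall_lt_add_mul (a := p x + r * l) (c := c)
    intro n hn
    have := hfQ p _ (hQ p r hq (r + n) (by linarith))
    linarith
  rcases hl0.lt_or_eq with hl0 | hl0
  -- Every affine function in `Q` lies below this point, so it belongs to `P`; the minorant `(p₀,
  -- r₀)` fails there.
  · have hP : (-(l⁻¹ • x), -(l⁻¹ * c)) ∈ P := by
      by_contra hP
      obtain ⟨p, r, hq, hlt⟩ := hsup _ _ hP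
      have := mul_lt_mul_of_pos_left (hfQ p r hq) (inv_pos.2 hl0)
      rw [mul_add, mul_comm r l, inv_mul_cancel_left₀ hl0.ne'] at this
      rw [map_neg, map_smul, smul_eq_mul] at hlt
      linarith
    have h := h₀ _ _ hP
    have := mul_lt_mul_of_pos_left hc (inv_pos.2 hl0)
    rw [mul_add, mul_comm r₀ l, inv_mul_cancel_left₀ hl0.ne'] at this
    rw [map_neg, map_smul, smul_eq_mul] at h
    linarith
  · rw [← hl0] at hc hfQ
    -- When `l = 0`, `(-x, -c)` is a recession direction of `P`, along which the minorant is
    -- eventually violated.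
    have hP : ∀ n : ℕ, (x₁ - (n : ℝ) • x, t₁ - n * c) ∈ P := by
      intro n
      by_contra hP
      obtain ⟨p, r, hq, hlt⟩ := hsup _ _ hP
      have h1 := hle p r hq _ _ h₁
      have h2 := mul_le_mul_of_nonneg_left (hfQ p r hq).le (Nat.cast_nonneg (α := ℝ) n)
      rw [map_sub, map_smul, smul_eq_mul] at hlt
      linarith
    have hc' : 0 < c - p₀ x := by linarith
    obtain ⟨n, hn⟩ := exists_nat_gt ((t₁ + r₀ - p₀ x₁) / (c - p₀ x))
    rw [div_lt_iff₀ hc'] at hn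
    have := h₀ _ _ (hP n)
    rw [map_sub, map_smul, smul_eq_mul] at this
    linarith

end WeakStar

/-! ### Finite values in the extended space. -/

section BulletLemmas

variable {Y : Type*}

@[simp] theorem fin_add_fin [Add Y] (a b : Y) :
    (fin a + fin b : Bullet Y) = fin (a + b) := rfl

@[simp] theorem posInf_add_fin [Add Y] (b : Y) : (posInf + fin b : Bullet Y) = posInf := rfl

@[simp] theorem fin_add_posInf [Add Y] (b : Y) : (fin b + posInf : Bullet Y) = posInf := rfl

@[simp] theorem posInf_add_posInf [Add Y] : (posInf + posInf : Bullet Y) = posInf := rfl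

@[simp] theorem negInf_add [Add Y] (b : Bullet Y) : (negInf + b : Bullet Y) = negInf := rfl

@[simp] theorem add_negInf [Add Y] (b : Bullet Y) : (b + negInf : Bullet Y) = negInf := by
  cases b <;> rfl

@[simp] theorem neg_fin [Neg Y] (a : Y) : (-fin a : Bullet Y) = fin (-a) := rfl

@[simp] theorem neg_posInf [Neg Y] : (-posInf : Bullet Y) = negInf := rfl

theorem weakLT_fin_iff [AddCommGroup Y] [TopologicalSpace Y] {K : Set Y} {a b : Y} :
    WeakLT K (fin a) (fin b) ↔ b - a ∈ interior K := by
  simp [WeakLT]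

theorem notMem_fin_image_iff {s : Set Y} {v : Bullet Y} :
    v ∉ fin '' s ↔ ∀ a, v = fin a → a ∉ s := by
  constructor
  · rintro h a rfl ha
    exact h ⟨a, ha, rfl⟩
  · rintro h ⟨a, ha, rfl⟩
    exact h a rfl ha

theorem add_eq_fin_iff [Add Y] {v w : Bullet Y} {c : Y} :
    v + w = fin c ↔ ∃ a b, v = fin a ∧ w = fin b ∧ a + b = c := by
  cases v <;> cases w <;> simp

theorem map_eq_fin_iff {Z : Type*} {T : Z → Y} {v : Bullet Z} {c : Y} :
    v.map T = fin c ↔ ∃ z, v = fin z ∧ T z = c := by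
  cases v <;> simp [Bullet.map]

theorem indic_eq_fin_iff {X : Type*} [Zero Y] {C : Set X} {x : X} {c : Y} :
    indic C x = fin c ↔ x ∈ C ∧ c = 0 := by
  unfold indic
  split_ifs with h <;> simp [h, eq_comm]

theorem mem_epi_iff {X : Type*} [Add Y] {K : Set Y} {F : X → Bullet Y} {x : X} {y : Y} :
    (x, y) ∈ epi K F ↔ ∃ a, F x = fin a ∧ ∃ κ ∈ K, y = a + κ := by
  unfold epi
  constructor
  · rintro ⟨κ, hκ, h⟩
    obtain ⟨a, b, ha, hb, hab⟩ := add_eq_fin_iff.1 h.symm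
    cases hb
    exact ⟨a, ha, κ, hκ, hab.symm⟩
  · rintro ⟨a, ha, κ, hκ, rfl⟩
    exact ⟨κ, hκ, by simp [ha]⟩

theorem lagrangian_eq_fin_iff {X Z : Type*} [AddMonoid Y] {F : X → Bullet Y} {C : Set X}
    {G : X → Bullet Z} {T : Z → Y} {x : X} {c : Y} :
    F x + indic C x + (G x).map T = fin c ↔
      x ∈ C ∧ ∃ a z, F x = fin a ∧ G x = fin z ∧ a + T z = c := by
  simp only [add_eq_fin_iff, map_eq_fin_iff, indic_eq_fin_iff]
  constructor
  · rintro ⟨_, _, ⟨a, _, ha, ⟨hx, rfl⟩, rfl⟩, ⟨z, hz, rfl⟩, rfl⟩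
    exact ⟨hx, a, z, ha, hz, by simp⟩
  · rintro ⟨hx, a, z, ha, hz, rfl⟩
    exact ⟨a, T z, ⟨a, 0, ha, ⟨hx, rfl⟩, by simp⟩, ⟨z, hz, rfl⟩, rfl⟩

end BulletLemmas

/-! ### Interiors of cones and positive functionals. -/

section Cone

variable {Y : Type*} [AddCommGroup Y] [Module ℝ Y] [TopologicalSpace Y]

theorem add_mem_interior_cone [IsTopologicalAddGroup Y] {K : ProperCone ℝ Y} {a b : Y} (ha : a ∈ K)
    (hb : b ∈ interior (K : Set Y)) : a + b ∈ interior (K : Set Y) := by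
  have h : (K : Set Y) + interior (K : Set Y) ⊆ (K : Set Y) := by
    rintro _ ⟨x, hx, y, hy, rfl⟩
    exact K.add_mem hx (interior_subset hy)
  exact interior_maximal h isOpen_interior.add_left (Set.add_mem_add ha hb)

theorem smul_mem_interior_cone [ContinuousSMul ℝ Y] {K : ProperCone ℝ Y} {b : Y} {c : ℝ} (hc : 0 < c)
    (hb : b ∈ interior (K : Set Y)) : c • b ∈ interior (K : Set Y) := by
  have h : c • (K : Set Y) ⊆ K := by
    rintro _ ⟨x, hx, rfl⟩
    exact K.smul_mem hx hc.le
  have h2 := interior_mono h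
  rw [interior_smul₀ hc.ne'] at h2
  exact h2 (Set.smul_mem_smul_set hb)

variable [IsTopologicalAddGroup Y] [ContinuousSMul ℝ Y]

theorem exists_sub_smul_mem_interior {s : Set Y} {b : Y} (hb : b ∈ interior s) (v : Y) :
    ∃ ε : ℝ, 0 < ε ∧ b - ε • v ∈ interior s := by
  have hc : Filter.Tendsto (fun t : ℝ => b - t • v) (𝓝[>] 0) (𝓝 b) := by
    have : Continuous fun t : ℝ => b - t • v := by fun_prop
    simpa using (this.tendsto 0).mono_left nhdsWithin_le_nhds
  obtain ⟨ε, h1, h2⟩ := ((hc.eventually (isOpen_interior.mem_nhds hb)).and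
    self_mem_nhdsWithin).exists
  exact ⟨ε, h2, h1⟩

/-- Otherwise `0 = a + (-a)` would be interior, and a cone that is a neighbourhood of `0` is the
whole space. -/
theorem neg_not_mem_interior_cone {K : ProperCone ℝ Y} (hK : (K : Set Y) ≠ univ) {a : Y}
    (ha : a ∈ K) : -a ∉ interior (K : Set Y) := by
  intro h
  have h0 : (0 : Y) ∈ interior (K : Set Y) := by
    simpa using add_mem_interior_cone ha h
  apply hK
  rw [eq_univ_iff_forall]
  intro v
  obtain ⟨ε, hε, hv⟩ := exists_sub_smul_mem_interior h0 (-v)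
  have := K.smul_mem (interior_subset hv) (inv_nonneg.2 hε.le)
  simpa [smul_smul, hε.ne'] using this

/-- If `f k = 0`, then `k - ε • v ∈ K` for small `ε > 0` gives `f v ≤ 0` for every `v`, so `f = 0`.
-/
theorem dualCone_pos_of_mem_interior {K : ProperCone ℝ Y} {f : Y →L[ℝ] ℝ}
    (hf : f ∈ dualCone (K : Set Y)) (hf0 : f ≠ 0) {k : Y} (hk : k ∈ interior (K : Set Y)) :
    0 < f k := by
  refine (hf k (interior_subset hk)).lt_of_ne fun h => hf0 ?_
  have key : ∀ v, f v ≤ 0 := by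
    intro v
    obtain ⟨ε, hε, hv⟩ := exists_sub_smul_mem_interior hk v
    have := hf _ (interior_subset hv)
    rw [map_sub, map_smul, ← h, smul_eq_mul] at this
    nlinarith
  ext v
  have := key (-v)
  rw [map_neg] at this
  exact le_antisymm (key v) (neg_nonpos.1 this)

end Cone

/-! ### Weak suprema and epigraphs of conjugates. -/

section Conj

variable {X Y : Type*} [AddCommGroup X] [Module ℝ X] [TopologicalSpace X]
  [AddCommGroup Y] [Module ℝ Y] [TopologicalSpace Y]
  [IsTopologicalAddGroup Y] [ContinuousSMul ℝ Y]

/-- A point that is nowhere weakly below a nonempty set of finite points dominates a weakly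
supremal one. -/
theorem exists_finite_weakSup {K : ProperCone ℝ Y} {k : Y} (hk : k ∈ interior (K : Set Y))
    {M : Set Y} (hM : M.Nonempty) {y : Y}
    (hy : ∀ w ∈ M, w - y ∉ interior (K : Set Y)) :
    ∃ s : ℝ, 0 ≤ s ∧ (∀ w ∈ M, w - (y - s • k) ∉ interior (K : Set Y)) ∧
      ∀ i ∈ interior (K : Set Y), ∃ w ∈ M, w - (y - s • k - i) ∈ interior (K : Set Y) := by
  -- `y` is lowered along `k` as far as possible: `T` is closed and bounded above, and its maximum
  -- gives the weakly supremal point.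
  set T : Set ℝ := {t | ∀ w ∈ M, w - (y - t • k) ∉ interior (K : Set Y)} with hT
  have hTc : IsClosed T := by
    have : T = ⋂ w ∈ M, (fun t : ℝ => w - (y - t • k)) ⁻¹' (interior (K : Set Y))ᶜ := by
      ext t; simp [hT]
    rw [this]
    exact isClosed_biInter fun w _ =>
      isOpen_interior.isClosed_compl.preimage (by fun_prop)
  have h0 : (0 : ℝ) ∈ T := by intro w hw; simpa using hy w hw
  have hup : ∀ (t t' : ℝ) (w : Y), t ≤ t' → w - (y - t • k) ∈ interior (K : Set Y) →
      w - (y - t' • k) ∈ interior (K : Set Y) := by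
    intro t t' w htt hw
    have := add_mem_interior_cone (K.smul_mem (interior_subset hk) (sub_nonneg.2 htt)) hw
    convert this using 1
    module
  have hTb : BddAbove T := by
    obtain ⟨w, hw⟩ := hM
    obtain ⟨ε, hε, hv⟩ := exists_sub_smul_mem_interior hk (y - w)
    refine ⟨ε⁻¹, fun t ht => ?_⟩
    by_contra! hlt
    refine ht w hw (hup ε⁻¹ t w hlt.le ?_)
    have := smul_mem_interior_cone (inv_pos.2 hε) hv
    rw [smul_sub, smul_smul, inv_mul_cancel₀ hε.ne', one_smul] at this
    convert this using 1
    abel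
  refine ⟨sSup T, le_csSup hTb h0, hTc.csSup_mem ⟨0, h0⟩ hTb, fun i hi => ?_⟩
  obtain ⟨ε, hε, hv⟩ := exists_sub_smul_mem_interior hi k
  have : sSup T + ε ∉ T := fun h => by linarith [le_csSup hTb h]
  simp only [hT, mem_ofPred_eq, not_forall, not_not] at this
  obtain ⟨w, hw, h⟩ := this
  refine ⟨w, hw, ?_⟩
  have := add_mem_interior_cone (interior_subset hv) h
  convert this using 1
  module

/-- The epigraph of the conjugate in terms of the values of the mapping. -/
theorem mem_epiConj_iff {K : ProperCone ℝ Y} {k : Y} (hk : k ∈ interior (K : Set Y))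
    {H : X → Bullet Y} (hH : ∀ x, H x ≠ negInf) (hfin : ∃ x a, H x = fin a)
    (L : X →Lₚₜ[ℝ] Y) (y : Y) :
    (L, y) ∈ epiConj (K : Set Y) H ↔
      ∀ x a, H x = fin a → y - L x + a ∉ -interior (K : Set Y) := by
  constructor
  · rintro ⟨v, hv, κ, hκ, hvκ⟩ x a hx h
    obtain ⟨v, _, rfl, hb, rfl⟩ := add_eq_fin_iff.1 hvκ.symm
    cases hb
    refine hv.1 _ ⟨x, rfl⟩ ?_
    change WeakLT (K : Set Y) _ (fin (L x) + -H x)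
    rw [hx, neg_fin, fin_add_fin, weakLT_fin_iff]
    have := add_mem_interior_cone hκ (Set.mem_neg.1 h)
    convert this using 1
    abel
  · intro h
    set M : Set Y := {w | ∃ x a, H x = fin a ∧ w = L x - a} with hM
    obtain ⟨x₀, a₀, hx₀⟩ := hfin
    obtain ⟨s, hs, h1, h2⟩ := exists_finite_weakSup hk (M := M) ⟨_, x₀, a₀, hx₀, rfl⟩
      (y := y) (by
        rintro w ⟨x, a, hx, rfl⟩ hw
        refine h x a hx ?_
        rw [Set.mem_neg]
        convert hw using 1
        abel)
    refine ⟨fin (y - s • k), ⟨?_, ?_⟩, s • k, K.smul_mem (interior_subset hk) hs, by simp⟩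
    · rintro _ ⟨x, rfl⟩
      change ¬ WeakLT (K : Set Y) _ (fin (L x) + -H x)
      cases hx : H x with
      | negInf => exact absurd hx (hH x)
      | posInf => simp [WeakLT]
      | fin a =>
        rw [neg_fin, fin_add_fin, weakLT_fin_iff]
        convert h1 _ ⟨x, a, hx, rfl⟩ using 3
        abel
    · intro t ht
      cases t with
      | negInf =>
        refine ⟨_, ⟨x₀, rfl⟩, ?_⟩
        simp [hx₀, WeakLT]
      | posInf => exact ht.elim
      | fin t =>
        obtain ⟨_, ⟨x, a, hx, rfl⟩, hw⟩ := h2 (y - s • k - t) (by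
          exact weakLT_fin_iff.1 ht)
        refine ⟨_, ⟨x, rfl⟩, ?_⟩
        change WeakLT (K : Set Y) _ (fin (L x) + -H x)
        rw [hx, neg_fin, fin_add_fin, weakLT_fin_iff]
        convert hw using 1
        abel

end Conj

/-! ### The scalarized perturbed epigraph. -/

section ScalarEpi

variable {X Y Z : Type*}

/-- The epigraph of the perturbed scalarized problem: the triples `(x, z, t)` with `x ∈ C`,
`f (F x) ≤ t` and `z ∈ G x + S`. -/
def scalarEpi [Add Z] (S : Set Z) (f : Y → ℝ) (F : X → Bullet Y) (C : Set X) (G : X → Bullet Z) :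
    Set (X × Z × ℝ) :=
  {p | p.1 ∈ C ∧ (∃ a, F p.1 = fin a ∧ f a ≤ p.2.2) ∧ (p.1, p.2.1) ∈ epi S G}

theorem isClosed_scalarEpi [TopologicalSpace X] [Add Z] [TopologicalSpace Z]
    {S : Set Z} {f : Y → ℝ} {F : X → Bullet Y} {C : Set X}
    {G : X → Bullet Z} (hF : ∀ x, F x ≠ negInf)
    (hf : LowerSemicontinuous fun x => (F x).toEReal f)
    (hC : IsClosed C) (hG : IsClosed (epi S G)) : IsClosed (scalarEpi S f F C G) := by
  have h : scalarEpi S f F C G = (Prod.fst ⁻¹' C) ∩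
      ((fun p : X × Z × ℝ => (p.1, ((p.2.2 : ℝ) : EReal))) ⁻¹'
        {q : X × EReal | (F q.1).toEReal f ≤ q.2}) ∩
      ((fun p : X × Z × ℝ => (p.1, p.2.1)) ⁻¹' epi S G) := by
    ext ⟨x, z, t⟩
    have key : (∃ a, F x = fin a ∧ f a ≤ t) ↔ (F x).toEReal f ≤ (t : EReal) := by
      cases hx : F x with
      | negInf => exact absurd hx (hF x)
      | posInf => simp [toEReal]
      | fin a => simp [toEReal]
    change (x ∈ C ∧ (∃ a, F x = fin a ∧ f a ≤ t) ∧ (x, z) ∈ epi S G) ↔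
      (x ∈ C ∧ (F x).toEReal f ≤ (t : EReal)) ∧ (x, z) ∈ epi S G
    rw [key, and_assoc]
  rw [h]
  exact ((hC.preimage continuous_fst).inter (hf.isClosed_epigraph.preimage
    (continuous_fst.prodMk (continuous_coe_real_ereal.comp
      (continuous_snd.comp continuous_snd))))).inter
    (hG.preimage (continuous_fst.prodMk (continuous_fst.comp continuous_snd)))

/-- `K`-convexity bounds the value of `F` at a convex combination only up to an element of `K`; `f ≥
0` on `K` turns this into a scalar inequality. -/
theorem convex_scalarEpi [AddCommGroup X] [Module ℝ X]
    [AddCommGroup Y] [Module ℝ Y] [TopologicalSpace Y] [AddCommGroup Z] [Module ℝ Z]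
    {K : Set Y} {S : Set Z} {f : Y →L[ℝ] ℝ} {F : X → Bullet Y}
    {C : Set X} {G : X → Bullet Z} (h0 : (0 : Y) ∈ K) (hf : f ∈ dualCone K)
    (hF : Convex ℝ (epi K F)) (hC : Convex ℝ C) (hG : Convex ℝ (epi S G)) :
    Convex ℝ (scalarEpi S f F C G) := by
  rintro ⟨x, z, t⟩ ⟨hx, ⟨a, ha, hat⟩, hz⟩ ⟨x', z', t'⟩ ⟨hx', ⟨a', ha', hat'⟩, hz'⟩ α β hα hβ hαβ
  refine ⟨hC hx hx' hα hβ hαβ, ?_, hG hz hz' hα hβ hαβ⟩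
  have h1 : (x, a) ∈ epi K F := mem_epi_iff.2 ⟨a, ha, 0, h0, by simp⟩
  have h2 : (x', a') ∈ epi K F := mem_epi_iff.2 ⟨a', ha', 0, h0, by simp⟩
  obtain ⟨b, hb, κ, hκ, hab⟩ := mem_epi_iff.1 (hF h1 h2 hα hβ hαβ)
  refine ⟨b, hb, ?_⟩
  have h3 : f (α • a + β • a') = f (b + κ) := congrArg f hab
  rw [map_add, map_add, map_smul, map_smul, smul_eq_mul, smul_eq_mul] at h3
  have h4 := hf κ hκ
  have h5 := mul_le_mul_of_nonneg_left hat hα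
  have h6 := mul_le_mul_of_nonneg_left hat' hβ
  change f b ≤ α * t + β * t'
  dsimp only at h5 h6
  linarith

end ScalarEpi

/-! ### Scalarization of weak efficiency. -/

section Scalarization

variable {X Y : Type*} [AddCommGroup X] [Module ℝ X]
  [AddCommGroup Y] [Module ℝ Y] [TopologicalSpace Y]
  [IsTopologicalAddGroup Y] [ContinuousSMul ℝ Y]

/-- Weak efficiency over a convex set is witnessed by a normalized positive functional. -/
theorem exists_scalarization {K : ProperCone ℝ Y} {k : Y} (hk : k ∈ interior (K : Set Y))
    {F : X → Bullet Y} (hF : Convex ℝ (epi (K : Set Y) F)) {A : Set X} (hA : Convex ℝ A)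
    (hne : ∃ x ∈ A, ∃ a, F x = fin a) (L : X →ₗ[ℝ] Y) (y : Y)
    (h : ∀ x ∈ A, ∀ a, F x = fin a → y - L x + a ∉ -interior (K : Set Y)) :
    ∃ f ∈ dualCone (K : Set Y), f k = 1 ∧
      ∀ x ∈ A, ∀ a, F x = fin a → 0 ≤ f (y - L x + a) := by
  -- The values `y - L x + F x` need not form a convex set; adding `K` makes it convex, and it still
  -- misses `-interior K`.
  set M : Set Y := {b | ∃ x ∈ A, (x, b + L x - y) ∈ epi (K : Set Y) F} with hM
  have hMc : Convex ℝ M := by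
    rintro b ⟨x, hx, hb⟩ b' ⟨x', hx', hb'⟩ α β hα hβ hαβ
    refine ⟨α • x + β • x', hA hx hx' hα hβ hαβ, ?_⟩
    have := hF hb hb' hα hβ hαβ
    convert this using 1
    ext
    · rfl
    · simp only [map_add, map_smul, Prod.snd_add, Prod.smul_snd]
      have : y = (α + β) • y := by rw [hαβ, one_smul]
      nth_rewrite 1 [this]
      module
  have hmem : ∀ x ∈ A, ∀ a, F x = fin a → ∀ κ ∈ K, y - L x + a + κ ∈ M := by
    intro x hx a ha κ hκ
    exact ⟨x, hx, mem_epi_iff.2 ⟨a, ha, κ, hκ, by abel⟩⟩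
  have hdisj : Disjoint (-interior (K : Set Y)) M := by
    rw [Set.disjoint_left]
    rintro b hb ⟨x, hx, hbx⟩
    obtain ⟨a, ha, κ, hκ, hab⟩ := mem_epi_iff.1 hbx
    refine h x hx a ha ?_
    have := add_mem_interior_cone hκ (Set.mem_neg.1 hb)
    rw [Set.mem_neg]
    convert this using 1
    have hκ' : κ = b + L x - y - a := by rw [hab]; abel
    rw [hκ']
    abel
  obtain ⟨f, c, hfc, hfM⟩ := geometric_hahn_banach_open
    (K.convex.interior.neg) isOpen_interior.neg hMc hdisj
  obtain ⟨x₁, hx₁, a₁, ha₁⟩ := hne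
  have hfK : f ∈ dualCone (K : Set Y) := by
    intro κ hκ
    apply nonneg_of_forall_lt_add_mul (a := f (y - L x₁ + a₁)) (c := c - 1)
    intro n hn
    have := hfM _ (hmem x₁ hx₁ a₁ ha₁ (n • κ) (K.smul_mem hκ hn))
    rw [map_add f _ (n • κ), map_smul, smul_eq_mul] at this
    linarith
  have hc : 0 ≤ c := by
    have hpos := hfK k (interior_subset hk)
    by_contra! hc
    -- Negative multiples of `k` approach `0`, so `c < 0` is impossible; the `+ 1` is there because
    -- only `0 ≤ f k` is known so far.
    have hlt : 0 < (-c) / (f k + 1) := div_pos (by linarith) (by linarith)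
    have := hfc (-(((-c) / (f k + 1)) • k))
      (by simpa using smul_mem_interior_cone hlt hk)
    rw [map_neg, map_smul, smul_eq_mul] at this
    have h1 : (-c) / (f k + 1) * (f k + 1) = -c := div_mul_cancel₀ _ (by linarith)
    nlinarith
  have hf0 : f ≠ 0 := by
    rintro rfl
    have h1 := hfc (-k) (by simpa using hk)
    have h2 := hfM _ (hmem x₁ hx₁ a₁ ha₁ 0 K.zero_mem)
    exact absurd (h1.trans_le h2) (by simp)
  have hfk := dualCone_pos_of_mem_interior hfK hf0 hk
  refine ⟨(f k)⁻¹ • f, fun κ hκ => mul_nonneg (inv_nonneg.2 hfk.le) (hfK κ hκ), ?_, ?_⟩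
  · exact inv_mul_cancel₀ hfk.ne'
  · intro x hx a ha
    have := hfM _ (hmem x hx a ha 0 K.zero_mem)
    rw [add_zero] at this
    exact mul_nonneg (inv_nonneg.2 hfk.le) (hc.trans this)

end Scalarization

/-! ### Transfer from the weak-* dual to a section. -/

section SectionalHull

variable {X Y : Type*} [AddCommGroup X] [Module ℝ X] [TopologicalSpace X]
  [AddCommGroup Y] [Module ℝ Y] [TopologicalSpace Y]
  [IsTopologicalAddGroup Y] [ContinuousSMul ℝ Y]

/-- The affine parametrization of the section `E_k + (L, y)`, based at the point `(p₀, r₀)`. -/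
noncomputable def sectionMap (k : Y) (L : X →Lₚₜ[ℝ] Y) (y : Y) (p₀ : WeakDual ℝ X) (r₀ : ℝ)
    (q : WeakDual ℝ X × ℝ) : (X →Lₚₜ[ℝ] Y) × Y :=
  (L + (show X →Lₚₜ[ℝ] Y from kdot k (WeakDual.toStrongDual (q.1 - p₀))), y + (q.2 - r₀) • k)

theorem sectionMap_fst_apply (k : Y) (L : X →Lₚₜ[ℝ] Y) (y : Y) (p₀ : WeakDual ℝ X) (r₀ : ℝ)
    (q : WeakDual ℝ X × ℝ) (x : X) :
    (sectionMap k L y p₀ r₀ q).1 x = L x + (q.1 x - p₀ x) • k := rfl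

/-- Weak-* convergence is pointwise convergence, exactly what the topology of the target tests. -/
theorem continuous_sectionMap (k : Y) (L : X →Lₚₜ[ℝ] Y) (y : Y) (p₀ : WeakDual ℝ X) (r₀ : ℝ) :
    Continuous (sectionMap k L y p₀ r₀) := by
  refine Continuous.prodMk (PointwiseConvergenceCLM.continuous_of_continuous_eval fun x => ?_)
    (by fun_prop)
  have h : Continuous fun q : WeakDual ℝ X × ℝ => q.1 x :=
    (WeakDual.eval_continuous x).comp continuous_fst
  exact continuous_const.add ((h.sub continuous_const).smul continuous_const)

theorem sectionMap_mem_section (k : Y) (L : X →Lₚₜ[ℝ] Y) (y : Y) (p₀ : WeakDual ℝ X) (r₀ : ℝ)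
    (q : WeakDual ℝ X × ℝ) :
    sectionMap k L y p₀ r₀ q ∈ (Ek (X := X) k : Set ((X →Lₚₜ[ℝ] Y) × Y)) + {(L, y)} := by
  rw [Set.add_singleton]
  refine ⟨sectionMap k L y p₀ r₀ q - (L, y), ⟨WeakDual.toStrongDual (q.1 - p₀), q.2 - r₀,
    fun x => ?_, ?_⟩, sub_add_cancel _ _⟩
  · change (sectionMap k L y p₀ r₀ q).1 x - L x = _
    rw [sectionMap_fst_apply, add_sub_cancel_left]
    rfl
  · exact add_sub_cancel_left _ _

theorem sectionMap_combo (k : Y) (L : X →Lₚₜ[ℝ] Y) (y : Y) (p₀ : WeakDual ℝ X) (r₀ : ℝ)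
    (q q' : WeakDual ℝ X × ℝ) {α β : ℝ} (h : α + β = 1) :
    sectionMap k L y p₀ r₀ (α • q + β • q') =
      α • sectionMap k L y p₀ r₀ q + β • sectionMap k L y p₀ r₀ q' := by
  obtain rfl : β = 1 - α := by linarith
  refine Prod.ext (ContinuousLinearMap.ext fun x => ?_) ?_
  · change (sectionMap k L y p₀ r₀ (α • q + (1 - α) • q')).1 x =
      α • (sectionMap k L y p₀ r₀ q).1 x + (1 - α) • (sectionMap k L y p₀ r₀ q').1 x
    simp only [sectionMap_fst_apply]
    change L x + (α * q.1 x + (1 - α) * q'.1 x - p₀ x) • k = _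
    module
  · change y + (α * q.2 + (1 - α) * q'.2 - r₀) • k =
      α • (y + (q.2 - r₀) • k) + (1 - α) • (y + (q'.2 - r₀) • k)
    module

/-- The map is affine with range in one section, so preimages of sectionally convex sets are convex;
continuity then handles closures. -/
theorem sectionMap_mem_closure_secHull {k : Y} {L : X →Lₚₜ[ℝ] Y} {y : Y} {p₀ : WeakDual ℝ X}
    {r₀ : ℝ} {Q : Set (WeakDual ℝ X × ℝ)} {N : Set ((X →Lₚₜ[ℝ] Y) × Y)}
    (h : ∀ q ∈ Q, sectionMap k L y p₀ r₀ q ∈ N) {q : WeakDual ℝ X × ℝ}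
    (hq : q ∈ closure (convexHull ℝ Q)) :
    sectionMap k L y p₀ r₀ q ∈ closure (secHull (Ek k) N) := by
  refine map_mem_closure (continuous_sectionMap k L y p₀ r₀) hq fun q hq => ?_
  rintro M ⟨hNM, hM⟩
  have hc : Convex ℝ (sectionMap k L y p₀ r₀ ⁻¹' M) := by
    intro a ha b hb α β hα hβ hαβ
    rw [mem_preimage, sectionMap_combo k L y p₀ r₀ a b hαβ]
    exact (hM (L, y) ⟨ha, sectionMap_mem_section k L y p₀ r₀ a⟩
      ⟨hb, sectionMap_mem_section k L y p₀ r₀ b⟩ hα hβ hαβ).1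
  have hQM : Q ⊆ sectionMap k L y p₀ r₀ ⁻¹' M := fun p hp => hNM (h p hp)
  exact mem_preimage.1 (convexHull_min hQM hc hq)

end SectionalHull

/-! ### Feasibility and the qualifying set. -/

theorem mem_fin_image_neg_iff {X Z : Type*} [AddCommGroup Z] {S : Set Z} {G : X → Bullet Z} {x : X} :
    G x ∈ fin '' (-S) ↔ (x, (0 : Z)) ∈ epi S G := by
  rw [mem_epi_iff]
  constructor
  · rintro ⟨z, hz, h⟩
    exact ⟨z, h.symm, -z, hz, by simp⟩
  · rintro ⟨z, h, s, hs, h0⟩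
    refine ⟨z, ?_, h.symm⟩
    rw [Set.mem_neg, neg_eq_of_add_eq_zero_right h0.symm]
    exact hs

section Farkas

variable {X Y Z U : Type*}
  [AddCommGroup X] [Module ℝ X] [TopologicalSpace X]
  [AddCommGroup Y] [Module ℝ Y] [TopologicalSpace Y] [IsTopologicalAddGroup Y]
  [ContinuousSMul ℝ Y]
  [AddCommGroup Z] [Module ℝ Z] [TopologicalSpace Z]

/-- Membership in the qualifying set, in terms of values of the Lagrangians. -/
theorem mem_qualSet_iff {K : ProperCone ℝ Y} {S : Set Z} {k : Y}
    (hk : k ∈ interior (K : Set Y)) {F : X → Bullet Y} (hF : ∀ x, F x ≠ negInf)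
    {G : U → X → Bullet Z} (hG : ∀ u x, G u x ≠ negInf) {C : Set X}
    (hfin : ∃ x ∈ C, (∃ a, F x = fin a) ∧ ∀ u, ∃ z, G u x = fin z)
    (L : X →Lₚₜ[ℝ] Y) (y : Y) :
    (L, y) ∈ qualSet (K : Set Y) S F G C k ↔
      ∃ z' ∈ dualCone S, ∃ u, ∀ x ∈ C, ∀ a z, F x = fin a → G u x = fin z →
        y - L x + (a + z' z • k) ∉ -interior (K : Set Y) := by
  simp only [qualSet, mem_iUnion, exists_prop]
  refine exists_congr fun z' => and_congr_right fun _ => exists_congr fun u => ?_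
  rw [mem_epiConj_iff hk]
  · simp only [lagrangian_eq_fin_iff]
    constructor
    · intro h x hx a z ha hz
      exact h x _ ⟨hx, a, z, ha, hz, rfl⟩
    · rintro h x _ ⟨hx, a, z, ha, hz, rfl⟩
      exact h x hx a z ha hz
  · intro x
    have h1 := hF x
    have h2 := hG u x
    unfold indic
    cases hFx : F x <;> cases hGx : G u x <;> split_ifs <;> simp_all [Bullet.map]
  · obtain ⟨x, hx, ⟨a, ha⟩, hz⟩ := hfin
    obtain ⟨z, hz⟩ := hz u
    exact ⟨x, _, lagrangian_eq_fin_iff.2 ⟨hx, a, z, ha, hz, rfl⟩⟩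

/-- Robust weak efficiency places a pair in the closed sectionally convex hull of the
qualifying set. -/
theorem mem_closure_secHull_qualSet [IsTopologicalAddGroup X] [ContinuousSMul ℝ X]
    [LocallyConvexSpace ℝ X] [IsTopologicalAddGroup Z] [ContinuousSMul ℝ Z]
    [LocallyConvexSpace ℝ Z] [Nonempty U]
    {K : ProperCone ℝ Y} {S : ProperCone ℝ Z} {k : Y} (hk : k ∈ interior (K : Set Y))
    {F : X → Bullet Y} (hF : ∀ x, F x ≠ negInf)
    {G : U → X → Bullet Z} (hG : ∀ u x, G u x ≠ negInf) {C : Set X}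
    (hA : ∃ x ∈ C, (∃ a, F x = fin a) ∧ ∀ u, (x, (0 : Z)) ∈ epi (S : Set Z) (G u))
    (hFconv : Convex ℝ (epi (K : Set Y) F)) (hFlsc : IsPosKLsc (K : Set Y) F)
    (hGconv : ∀ u, Convex ℝ (epi (S : Set Z) (G u)))
    (hGclosed : ∀ u, IsClosed (epi (S : Set Z) (G u)))
    (hCclosed : IsClosed C) (hCconv : Convex ℝ C) {L : X →Lₚₜ[ℝ] Y} {y : Y}
    (h : ∀ x ∈ C, (∀ u, (x, (0 : Z)) ∈ epi (S : Set Z) (G u)) → ∀ a, F x = fin a →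
      y - L x + a ∉ -interior (K : Set Y)) :
    (L, y) ∈ closure (secHull (Ek k) (qualSet (K : Set Y) (S : Set Z) F G C k)) := by
  have hAconv : Convex ℝ {x | x ∈ C ∧ ∀ u, (x, (0 : Z)) ∈ epi (S : Set Z) (G u)} := by
    rintro x ⟨hx, hx0⟩ x' ⟨hx', hx0'⟩ α β hα hβ hαβ
    refine ⟨hCconv hx hx' hα hβ hαβ, fun u => ?_⟩
    simpa using hGconv u (hx0 u) (hx0' u) hα hβ hαβ
  obtain ⟨x₁, hx₁, ⟨a₁, ha₁⟩, hz₁⟩ := hA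
  obtain ⟨f, hfK, hfk, hf⟩ := exists_scalarization hk hFconv hAconv
    ⟨x₁, ⟨hx₁, hz₁⟩, a₁, ha₁⟩ (L : X →L[ℝ] Y).toLinearMap y (fun x hx => h x hx.1 hx.2)
  have hf0 : f ≠ 0 := by
    rintro rfl
    exact zero_ne_one hfk
  have hpos : ∀ b, 0 ≤ f b → b ∉ -interior (K : Set Y) := by
    intro b hb hbK
    have := dualCone_pos_of_mem_interior hfK hf0 (Set.mem_neg.1 hbK)
    rw [map_neg] at this
    linarith
  set D : U → Set (X × Z × ℝ) := fun u => scalarEpi (S : Set Z) f F C (G u) with hD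
  have hDc : ∀ u, IsClosed (D u) := fun u =>
    isClosed_scalarEpi hF (hFlsc f hfK hf0) hCclosed (hGclosed u)
  have hDv : ∀ u, Convex ℝ (D u) := fun u =>
    convex_scalarEpi K.zero_mem hfK hFconv hCconv (hGconv u)
  have hDS : ∀ u x z t, (x, z, t) ∈ D u → ∀ s ∈ S, (x, z + s, t) ∈ D u := by
    rintro u x z t ⟨hx, ha, hz⟩ s hs
    refine ⟨hx, ha, ?_⟩
    obtain ⟨z₀, h0, s', hs', h1⟩ := mem_epi_iff.1 hz
    exact mem_epi_iff.2 ⟨z₀, h0, s' + s, S.add_mem hs' hs, by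
      rw [← add_assoc]; exact congrArg (· + s) h1⟩
  have hDt : ∀ u x z t, (x, z, t) ∈ D u → ∀ t', t ≤ t' → (x, z, t') ∈ D u := by
    rintro u x z t ⟨hx, ⟨a, ha, hat⟩, hz⟩ t' ht
    exact ⟨hx, ⟨a, ha, le_trans hat ht⟩, hz⟩
  have hD₁ : ∀ u, (x₁, (0 : Z), f a₁) ∈ D u := fun u => ⟨hx₁, ⟨a₁, ha₁, le_rfl⟩, hz₁ u⟩
  have hD₂ : ∀ u, (x₁, (0 : Z), f a₁ - 1) ∉ D u := by
    rintro u ⟨-, ⟨a, ha, hat⟩, -⟩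
    obtain rfl : a = a₁ := Bullet.fin.inj (ha.symm.trans ha₁)
    dsimp only at hat
    linarith
  set Q : Set (WeakDual ℝ X × ℝ) := {q | ∃ z' ∈ dualCone (S : Set Z), ∃ u,
    ∀ x z t, (x, z, t) ∈ D u → q.1 x - q.2 ≤ t + z' z} with hQ
  set p₀ : WeakDual ℝ X := StrongDual.toWeakDual (f.comp (L : X →L[ℝ] Y)) with hp₀
  have hp₀x : ∀ x, p₀ x = f (L x) := fun x => rfl
  have hmem : (p₀, f y) ∈ closure (convexHull ℝ Q) := by
    refine mem_closure_convexHull_of_minorant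
      (P := {q | ∀ u, (q.1, (0 : Z), q.2) ∈ D u}) ?_ ?_ ?_ (x₁ := x₁) (t₁ := f a₁) hD₁ ?_
    · rintro p r ⟨z', hz', u, hu⟩ r' hr
      refine ⟨z', hz', u, fun x z t hx => ?_⟩
      have := hu x z t hx
      dsimp only at this ⊢
      linarith
    · rintro p r ⟨z', hz', u, hu⟩ x t hx
      simpa using hu x 0 t (hx u)
    -- A point outside the intersection misses `D u` for one `u`, so the Lagrangian of that single
    -- constraint cuts it off.
    · intro x M hx
      obtain ⟨u, hu⟩ := not_forall.1 hx
      obtain ⟨z', hz', p, r, hM, hm⟩ := exists_lagrangian_minorant (hDc u) (hDv u) (hDS u)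
        (hDt u) (hD₁ u) (hD₂ u) hu
      exact ⟨StrongDual.toWeakDual p, r, ⟨z', hz', u, hm⟩, hM⟩
    · intro x t hx
      obtain ⟨hxC, ⟨a, ha, hat⟩, -⟩ := hx (Classical.arbitrary U)
      have h1 : 0 ≤ f (y - L x + a) := hf x ⟨hxC, fun u => (hx u).2.2⟩ a ha
      rw [map_add, map_sub] at h1
      rw [hp₀x]
      dsimp only at hat
      linarith
  have hmap : sectionMap k L y p₀ (f y) (p₀, f y) = (L, y) := by
    refine Prod.ext (ContinuousLinearMap.ext fun x => ?_) ?_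
    · refine (sectionMap_fst_apply k L y p₀ (f y) _ x).trans ?_
      rw [sub_self, zero_smul, add_zero]
      rfl
    · simp [sectionMap]
  rw [← hmap]
  refine sectionMap_mem_closure_secHull ?_ hmem
  rintro ⟨p, r⟩ ⟨z', hz', u, hu⟩
  refine (mem_qualSet_iff hk hF hG ⟨x₁, hx₁, ⟨a₁, ha₁⟩, fun u => ?_⟩ _ _).2
    ⟨z', hz', u, fun x hx a z ha hz => hpos _ ?_⟩
  · obtain ⟨z, hz, -⟩ := mem_epi_iff.1 (hz₁ u)
    exact ⟨z, hz⟩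
  · have hxD : (x, z, f a) ∈ D u :=
      ⟨hx, ⟨a, ha, le_rfl⟩, mem_epi_iff.2 ⟨z, hz, 0, S.zero_mem, by simp⟩⟩
    have h1 := hu x z _ hxD
    -- Since `f k = 1`, the terms in `L` and `y` cancel, leaving `r - p x + f a + z' z`.
    change 0 ≤ f (y + (r - f y) • k - (L x + (p x - p₀ x) • k) + (a + z' z • k))
    simp only [map_add, map_sub, map_smul, smul_eq_mul, hfk, hp₀x]
    dsimp only at h1
    linarith

end Farkas

end RobustFarkas

open RobustFarkas RobustFarkas.Bullet in

/-- Stable robust convex vector Farkas lemma. -/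
theorem theorem5p4
    {X Y Z U : Type*}
    [AddCommGroup X] [Module ℝ X] [TopologicalSpace X] [IsTopologicalAddGroup X]
    [ContinuousSMul ℝ X] [LocallyConvexSpace ℝ X] [T2Space X]
    [AddCommGroup Y] [Module ℝ Y] [TopologicalSpace Y] [IsTopologicalAddGroup Y]
    [ContinuousSMul ℝ Y] [LocallyConvexSpace ℝ Y] [T2Space Y]
    [AddCommGroup Z] [Module ℝ Z] [TopologicalSpace Z] [IsTopologicalAddGroup Z]
    [ContinuousSMul ℝ Z] [LocallyConvexSpace ℝ Z] [T2Space Z]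
    [Nonempty U]
    -- the cones; `ProperCone` means: closed convex cone that contains the origin
    (K : ProperCone ℝ Y) (hKint : (interior (K : Set Y)).Nonempty)
    (hKne : (K : Set Y) ≠ Set.univ)
    (S : ProperCone ℝ Z)
    -- the data of the problem
    (F : X → RobustFarkas.Bullet Y) (hF : RobustFarkas.IsProper F)
    (G : U → X → RobustFarkas.Bullet Z) (hG : ∀ u, RobustFarkas.IsProper (G u))
    (C : Set X)
    (hA : (RobustFarkas.feasible C G (S : Set Z) ∩ RobustFarkas.dom F).Nonempty)
    -- the convexity hypothesis
    (hFconv : RobustFarkas.IsKConvex (K : Set Y) F)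
    (hFlsc : RobustFarkas.IsPosKLsc (K : Set Y) F)
    (hGconv : ∀ u, RobustFarkas.IsKConvex (S : Set Z) (G u))
    (hGclosed : ∀ u, RobustFarkas.IsKEpiClosed (S : Set Z) (G u))
    (hCne : C.Nonempty) (hCclosed : IsClosed C) (hCconv : Convex ℝ C)
    -- the sets of perturbations
    (V : Set (X →Lₚₜ[ℝ] Y)) (hV : V.Nonempty) (W : Set Y) (hW : W.Nonempty)
    -- the qualification condition
    (hA₂ : ∃ k ∈ interior (K : Set Y), RobustFarkas.IsSecConvexClosedRegarding k
      (RobustFarkas.qualSet (K : Set Y) (S : Set Z) F G C k) V W) :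
    (∀ L ∈ V, ∀ y ∈ W,
      ((∀ x ∈ C, (∀ u, G u x ∈ RobustFarkas.Bullet.fin '' (-(S : Set Z))) →
          .fin (y - L x) + F x ∉ RobustFarkas.Bullet.fin '' (-interior (K : Set Y))) ↔
        ∃ u, ∃ T ∈ RobustFarkas.posOp (S : Set Z) (K : Set Y), ∀ x ∈ C,
          F x + (G u x).map T + .fin (-L x + y) ∉
            RobustFarkas.Bullet.fin '' (-interior (K : Set Y)))) ∧
    (∀ L ∈ V, ∀ y ∈ W,
      ((∀ x ∈ C, (∀ u, G u x ∈ RobustFarkas.Bullet.fin '' (-(S : Set Z))) →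
          .fin (y - L x) + F x ∉ RobustFarkas.Bullet.fin '' (-interior (K : Set Y))) ↔
        ∃ u, ∃ T ∈ RobustFarkas.weakPosOp (S : Set Z) (K : Set Y), ∀ x ∈ C,
          F x + (G u x).map T + .fin (-L x + y) ∉
            RobustFarkas.Bullet.fin '' (-(T '' (S : Set Z)) - interior (K : Set Y)))) := by
  obtain ⟨k, hk, hQ⟩ := hA₂
  obtain ⟨x₁, ⟨hx₁C, hx₁G⟩, hx₁F⟩ := hA
  have hfin : ∃ a, F x₁ = fin a := by
    cases hF₁ : F x₁ with
    | negInf => exact absurd hF₁ (hF.2 x₁)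
    | posInf => exact absurd hF₁ hx₁F
    | fin a => exact ⟨a, rfl⟩
  have hz₁ : ∀ u, (x₁, (0 : Z)) ∈ epi (S : Set Z) (G u) := fun u =>
    mem_fin_image_neg_iff.1 (mem_iInter.1 hx₁G u)
  have robust_to_multiplier : ∀ L ∈ V, ∀ y ∈ W,
      (∀ x ∈ C, (∀ u, G u x ∈ fin '' (-(S : Set Z))) →
        fin (y - L x) + F x ∉ fin '' (-interior (K : Set Y))) →
      ∃ u, ∃ T ∈ posOp (S : Set Z) (K : Set Y), ∀ x ∈ C,
        F x + (G u x).map T + fin (-L x + y) ∉ fin '' (-interior (K : Set Y)) := by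
    intro L hL y hy h
    have hmem := mem_closure_secHull_qualSet hk hF.2 (fun u => (hG u).2)
      ⟨x₁, hx₁C, hfin, hz₁⟩ hFconv hFlsc hGconv hGclosed hCclosed hCconv (L := L) (y := y)
      (fun x hx hxG a ha => notMem_fin_image_iff.1
        (h x hx fun u => mem_fin_image_neg_iff.2 (hxG u)) _ (by rw [ha]; rfl))
    -- The qualification condition enters here, removing the closure and the hull.
    have hmem' : (L, y) ∈ qualSet (K : Set Y) (S : Set Z) F G C k :=
      (hQ.subset ⟨hmem, hL, hy⟩).1
    obtain ⟨z', hz', u, hu⟩ := (mem_qualSet_iff hk hF.2 (fun u => (hG u).2)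
      ⟨x₁, hx₁C, hfin, fun u => by
        obtain ⟨z, hz, -⟩ := mem_epi_iff.1 (hz₁ u)
        exact ⟨z, hz⟩⟩ L y).1 hmem'
    refine ⟨u, kdot k z', ?_, fun x hx => notMem_fin_image_iff.2 fun c hc => ?_⟩
    · rintro _ ⟨s, hs, rfl⟩
      exact K.smul_mem (interior_subset hk) (hz' s hs)
    · obtain ⟨_, _, hab, hb, rfl⟩ := add_eq_fin_iff.1 hc
      obtain ⟨a, _, ha, hT, rfl⟩ := add_eq_fin_iff.1 hab
      obtain ⟨z, hz, rfl⟩ := map_eq_fin_iff.1 hT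
      cases hb
      convert hu x hx a z ha hz using 2
      change a + z' z • k + (-L x + y) = _
      abel
  have pos_to_weakPos : ∀ (L : X →Lₚₜ[ℝ] Y) (y : Y),
      (∃ u, ∃ T ∈ posOp (S : Set Z) (K : Set Y), ∀ x ∈ C,
        F x + (G u x).map T + fin (-L x + y) ∉ fin '' (-interior (K : Set Y))) →
      ∃ u, ∃ T ∈ weakPosOp (S : Set Z) (K : Set Y), ∀ x ∈ C,
        F x + (G u x).map T + fin (-L x + y) ∉
          fin '' (-(T '' (S : Set Z)) - interior (K : Set Y)) := by
    rintro L y ⟨u, T, hT, h⟩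
    refine ⟨u, T, ?_, fun x hx hmem => h x hx (image_mono ?_ hmem)⟩
    · refine eq_empty_of_forall_notMem fun b hb => ?_
      exact neg_not_mem_interior_cone hKne (hT hb.1) hb.2
    · rintro _ ⟨b, hb, i, hi, rfl⟩
      rw [Set.mem_neg, neg_sub]
      have := add_mem_interior_cone (hT hb) hi
      convert this using 1
      abel
  have multiplier_to_robust : ∀ (L : X →Lₚₜ[ℝ] Y) (y : Y),
      (∃ u, ∃ T ∈ weakPosOp (S : Set Z) (K : Set Y), ∀ x ∈ C,
        F x + (G u x).map T + fin (-L x + y) ∉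
          fin '' (-(T '' (S : Set Z)) - interior (K : Set Y))) →
      ∀ x ∈ C, (∀ u, G u x ∈ fin '' (-(S : Set Z))) →
        fin (y - L x) + F x ∉ fin '' (-interior (K : Set Y)) := by
    rintro L y ⟨u, T, -, h⟩ x hx hxG
    refine notMem_fin_image_iff.2 fun c hc hcK => ?_
    obtain ⟨_, a, hb, ha, rfl⟩ := add_eq_fin_iff.1 hc
    cases hb
    obtain ⟨z, hz, hGz⟩ := hxG u
    refine h x hx ⟨a + T z + (-L x + y), ?_, by rw [ha, ← hGz]; rfl⟩
    -- Feasibility gives `-z ∈ S`, so `T z ∈ -T(S)` and a violation of (α) at `x` is one of (γ).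
    refine ⟨T z, ⟨-z, hz, map_neg T z⟩, -(y - L x + a), hcK, ?_⟩
    dsimp only
    abel
  exact ⟨fun L hL y hy => ⟨robust_to_multiplier L hL y hy, fun h =>
      multiplier_to_robust L y (pos_to_weakPos L y h)⟩,
    fun L hL y hy => ⟨fun h => pos_to_weakPos L y (robust_to_multiplier L hL y hy h),
      multiplier_to_robust L y⟩⟩
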